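/- Let $d\ge 2$, let $\nu_d$ be Lebesgue measure on $\mathbb R^d$, and let $\mathbb F$ be a nonzero Borel measure on $\mathbb R$ that is finite on bounded sets and concentrated on $(0,\infty)$. Let $\eta$ be a Poisson process on $\mathbb R^d\times(0,\infty)$ with intensity measure $\nu_d\times\mathbb F$. For $(x,h)\in\eta$ let $$C((x,h),\eta)=\{y\in\mathbb R^d:\ \|y-x\|^2+h\le\|y-x'\|^2+h'\ \text{ for all }(x',h')\in\eta\}$$ be its Laguerre cell, and for Borel sets $A\subseteq\mathbb R$ define the volume-biased weight distribution $$\mathbb F^V(A)=\mathbb E\Big(\sum_{(x,h)\in\eta}\mathbf 1_{[0,1]^d}(x)\,\mathbf 1_A(h)\,\nu_d\big(C((x,h),\eta)\big)\Big).$$ Put $F(z)=\mathbb F((0,z])$ and $F^V(z)=\mathbb F^V((0,z])$ for $z\ge 0$, and let $\kappa_d=\pi^{d/2}/\Gamma(1+\tfrac d2)$ be the volume of the unit ball of $\mathbb R^d$ and $\omega_d=2\pi^{d/2}/\Gamma(\tfrac d2)$ the surface area of its unit sphere. Then $\mathbb F^V$ is well defined (the sums are random variables) and is a probability measure on $\mathbb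 R$, and for every $z\ge 0$ $$F^V(z)=1-\exp\Big(-\kappa_d\int_0^z(z-t)^{d/2}\,dF(t)\Big)+\frac{\omega_d}{2}\int_z^\infty\exp\Big(-\kappa_d\int_0^u(u-t)^{d/2}\,dF(t)\Big)\int_0^z(u-h)^{d/2-1}\,dF(h)\,du,$$ where the integral over $(z,\infty)$ is finite and $\int_0^z\cdots dF$ denotes integration against $\mathbb F$ over $(0,z]$. -/

import Mathlib

open MeasureTheory ProbabilityTheory Set
open scoped NNReal ENNReal

section PointProcesses

variable {Ω X : Type*} [MeasurableSpace Ω] [MeasurableSpace X] [Bornology X]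

/-- Locally finite counting measures: integer-valued (possibly infinite on large sets), and finite
on bounded measurable sets. -/
def IsLocallyFiniteCounting (μ : Measure X) : Prop :=
  (∀ B : Set X, MeasurableSet B → ∃ n : ℕ∞, μ B = (n : ℝ≥0∞)) ∧
    ∀ B : Set X, MeasurableSet B → Bornology.IsBounded B → μ B < ∞

/-- The Poisson distribution with mean `m ∈ [0, ∞]`, as a law on `[0, ∞]`; for `m = ∞` it is the
point mass at `∞`. -/
noncomputable def poissonLaw (m : ℝ≥0∞) : Measure ℝ≥0∞ :=
  if m = ∞ then Measure.dirac ∞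
  else (poissonMeasure m.toNNReal).map (fun n : ℕ => (n : ℝ≥0∞))

/-- A point process: a random element of the space of locally finite counting measures.
The σ-algebra on `Measure X` is the one generated by the evaluations `μ ↦ μ B`, `B` measurable. -/
structure IsPointProcess (η : Ω → Measure X) : Prop where
  measurable : Measurable η
  counting : ∀ ω, IsLocallyFiniteCounting (η ω)

/-- `η` is a Poisson process with intensity measure `Λ` on the probability space `(Ω, P)`. -/
structure IsPoissonProcess (P : Measure Ω) (η : Ω → Measure X) (Λ : Measure X) : Prop
    extends IsPointProcess η where
  law : ∀ B : Set X, MeasurableSet B → HasLaw (fun ω => η ω B) (poissonLaw (Λ B)) P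
  indep : ∀ (m : ℕ) (B : Fin m → Set X), (∀ i, MeasurableSet (B i)) →
    Pairwise (fun i j => Disjoint (B i) (B j)) → iIndepFun (fun i ω => η ω (B i)) P

end PointProcesses

section Laguerre

variable {d : ℕ}

/-- The space `ℝ^d × (0, ∞)` of weighted points `(x, h)`. -/
abbrev WeightedPoint (d : ℕ) : Type := EuclideanSpace ℝ (Fin d) × Ioi (0 : ℝ)

/-- The Laguerre cell `C((x,h), φ)` of `p = (x,h)` in a configuration `φ` of weighted points. -/
def laguerreCell (p : WeightedPoint d) (φ : Set (WeightedPoint d)) :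
    Set (EuclideanSpace ℝ (Fin d)) :=
  {y | ∀ q ∈ φ, ‖y - p.1‖ ^ 2 + (p.2 : ℝ) ≤ ‖y - q.1‖ ^ 2 + (q.2 : ℝ)}

/-- The set of points of a counting measure, that is, its atoms. -/
def pointsOf (μ : Measure (WeightedPoint d)) : Set (WeightedPoint d) :=
  {q | μ {q} ≠ 0}

/-- The unit cube `[0,1]^d`. -/
def unitCube (d : ℕ) : Set (EuclideanSpace ℝ (Fin d)) :=
  {x | ∀ i, x i ∈ Icc (0 : ℝ) 1}

/-- The sum over the points `(x,h)` of the counting measure `μ` of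
`1_{[0,1]^d}(x) 1_A(h) vol(C((x,h), μ))`; summing over the points of a counting measure
is integrating against it. -/
noncomputable def volumeBiasedSum (μ : Measure (WeightedPoint d)) (A : Set ℝ) : ℝ≥0∞ :=
  ∫⁻ p, (unitCube d).indicator 1 p.1 * A.indicator 1 (p.2 : ℝ) *
    volume (laguerreCell p (pointsOf μ)) ∂μ

/-- The volume-biased weight distribution, as a set function:
`A ↦ 𝔼 ∑_{(x,h) ∈ η} 1_{[0,1]^d}(x) 1_A(h) vol(C((x,h), η))`. -/
noncomputable def volumeBiasedWeight {Ω : Type*} [MeasurableSpace Ω] (P : Measure Ω)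
    (η : Ω → Measure (WeightedPoint d)) (A : Set ℝ) : ℝ≥0∞ :=
  ∫⁻ ω, volumeBiasedSum (η ω) A ∂P

/-- The measure `ν_d × 𝔽` on `ℝ^d × (0, ∞)`, where `ν_d` is Lebesgue measure and `𝔽` is a measure
on `ℝ` concentrated on `(0, ∞)`. -/
noncomputable def intensity (d : ℕ) (𝔽 : Measure ℝ) : Measure (WeightedPoint d) :=
  (volume : Measure (EuclideanSpace ℝ (Fin d))).prod (𝔽.comap Subtype.val)

/-- `κ_d`, the volume of the unit ball of `ℝ^d`. -/
noncomputable def kappa (d : ℕ) : ℝ :=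
  (volume : Measure (EuclideanSpace ℝ (Fin d))).real (Metric.closedBall 0 1)

/-- `ω_d`, the surface measure of the unit sphere of `ℝ^d`. -/
noncomputable def omega (d : ℕ) : ℝ :=
  (volume : Measure (EuclideanSpace ℝ (Fin d))).toSphere.real univ

end Laguerre

/-!
For a site `y` let `power y (x, h) = ‖y - x‖² + h`. Since a locally finite counting measure is purely
atomic (`exists_measure_singleton_ne_zero`), `y` lies in the Laguerre cell of `p` exactly when the
process has no point in `{power y < power y p}` (`mem_laguerreCell_pointsOf_iff`). By Tonelli's
theorem the mean sum is therefore the integral over `y` of the mean number of points `p` of the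
process in `[0,1]^d × A` at which `power y` is minimal.

For a Poisson process with intensity `Λ`, a measurable function `T` such that all `Λ{T < r}` are
finite, and a measurable set `B`, the mean number of points in `B` minimizing `T` is
`∫_B exp(-Λ{T < T p}) Λ(dp)` (`IsPoissonProcess.lintegral_measure_lowest`). This instance of the
Mecke formula follows directly from independence: if `T p` is replaced by its dyadic floor, the
counts split into the layers `T ∈ [k 2⁻ᵐ, (k+1) 2⁻ᵐ)`, and each layer is disjoint from the set
`{T < k 2⁻ᵐ}` that has to be empty; then `m → ∞`.

Here `Λ{power y < s} = G(s) = κ_d ∫_{(0,s]} (s - t)^{d/2} 𝔽(dt)` for every `y`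
(`intensity_setOf_power_lt`), and `‖y‖²` has density `(ω_d / 2) r^{d/2-1}` under Lebesgue measure
(`map_norm_sq_volume`). Integrating over `y` shows that the volume-biased weight distribution has
density `h ↦ ∫_h^∞ (ω_d / 2) (u - h)^{d/2-1} exp(-G(u)) du` with respect to `𝔽`
(`volumeBiasedWeight_eq`).

Exchanging the integrals over `h` and `u` gives `∫ exp(-G(u)) g(u) du` for the part `u ≤ z`, where
`g(u) = (ω_d / 2) ∫_{(0,u]} (u - h)^{d/2-1} 𝔽(dh)`, and the last term of the claimed formula for
the part `u > z`. As `G` is the primitive of the right-continuous function `g`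
(`cumWeight_eq_integral`), the first part equals `1 - exp(-G(z))`
(`integral_exp_neg_cumWeight_mul`). Since `𝔽 ≠ 0`, `G` tends to infinity, so the total mass is `1`.
-/

section

open Filter Topology

/-! ### Poisson laws and Poisson processes -/

theorem lintegral_poissonLaw {m : ℝ≥0∞} (hm : m ≠ ∞) : ∫⁻ x, x ∂(poissonLaw m) = m := by
  lift m to ℝ≥0 using hm
  have hone := (hasSum_one_poissonMeasure m).tsum_eq
  have hsum := (hasSum_one_poissonMeasure m).summable
  have h0 : ∀ n : ℕ, 0 ≤ Real.exp (-m) * (m : ℝ) ^ n / (n.factorial : ℝ) := fun n => by positivity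
  rw [poissonLaw, if_neg ENNReal.coe_ne_top, lintegral_map measurable_id' .of_discrete,
    poissonMeasure, lintegral_sum_measure]
  simp only [lintegral_smul_measure, lintegral_dirac, smul_eq_mul, ENNReal.toNNReal_coe]
  rw [tsum_eq_zero_add' ENNReal.summable]
  have key : ∀ n : ℕ, ENNReal.ofReal (Real.exp (-m) * (m : ℝ) ^ (n + 1) /
      ((n + 1).factorial : ℝ)) * ((n + 1 : ℕ) : ℝ≥0∞) =
      m * ENNReal.ofReal (Real.exp (-m) * (m : ℝ) ^ n / (n.factorial : ℝ)) := by
    intro n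
    rw [← ENNReal.ofReal_natCast, ← ENNReal.ofReal_coe_nnreal (p := m),
      ← ENNReal.ofReal_mul (by positivity), ← ENNReal.ofReal_mul (by positivity)]
    congr 1
    rw [Nat.factorial_succ]
    push_cast
    field_simp
    ring
  simp only [key, ENNReal.tsum_mul_left]
  rw [← ENNReal.ofReal_tsum_of_nonneg h0 hsum, hone]
  simp

theorem poissonLaw_singleton_zero {m : ℝ≥0∞} (hm : m ≠ ∞) :
    poissonLaw m {0} = ENNReal.ofReal (Real.exp (-m.toReal)) := by
  rw [poissonLaw, if_neg hm, Measure.map_apply .of_discrete (measurableSet_singleton 0)]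
  have : (fun n : ℕ => (n : ℝ≥0∞)) ⁻¹' {0} = {0} := by ext; simp
  rw [this, poissonMeasure_singleton]
  simp [ENNReal.coe_toNNReal_eq_toReal]

section Poisson

variable {Ω X : Type*} [MeasurableSpace Ω] [MeasurableSpace X] [Bornology X]
  {P : Measure Ω} {η : Ω → Measure X} {Λ : Measure X}

namespace IsPoissonProcess

theorem measurable_count (hη : IsPoissonProcess P η Λ) {B : Set X} (hB : MeasurableSet B) :
    Measurable fun ω => η ω B :=
  (Measure.measurable_coe hB).comp hη.measurable

theorem lintegral_count (hη : IsPoissonProcess P η Λ) {B : Set X} (hB : MeasurableSet B)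
    (hfin : Λ B ≠ ∞) : ∫⁻ ω, η ω B ∂P = Λ B := by
  have h := (hη.law B hB).map_eq
  rw [← lintegral_map (f := fun x : ℝ≥0∞ => x) measurable_id' (hη.measurable_count hB), h,
    lintegral_poissonLaw hfin]

theorem measure_count_eq_zero (hη : IsPoissonProcess P η Λ) {B : Set X} (hB : MeasurableSet B)
    (hfin : Λ B ≠ ∞) : P {ω | η ω B = 0} = ENNReal.ofReal (Real.exp (-(Λ B).toReal)) := by
  have h := (hη.law B hB).map_eq
  rw [← poissonLaw_singleton_zero hfin, ← h,
    Measure.map_apply (hη.measurable_count hB) (measurableSet_singleton 0)]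
  rfl

/-- The mean number of points in `S` on the event that `S'` is empty, for disjoint `S`, `S'`. -/
theorem setLIntegral_count (hη : IsPoissonProcess P η Λ) {S S' : Set X}
    (hS : MeasurableSet S) (hS' : MeasurableSet S') (hd : Disjoint S S')
    (hfin : Λ S ≠ ∞) (hfin' : Λ S' ≠ ∞) :
    ∫⁻ ω in {ω | η ω S' = 0}, η ω S ∂P =
      Λ S * ENNReal.ofReal (Real.exp (-(Λ S').toReal)) := by
  have hind : IndepFun (fun ω => η ω S) (fun ω => η ω S') P := by
    have h := hη.indep 2 ![S, S'] (by intro i; fin_cases i <;> simpa) (by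
      intro i j hij
      fin_cases i <;> fin_cases j <;> simp_all [disjoint_comm])
    simpa using h.indepFun (i := 0) (j := 1) (by simp)
  have hm := hη.measurable_count hS
  have hset : MeasurableSet {ω | η ω S' = 0} :=
    hη.measurable_count hS' (measurableSet_singleton 0)
  have hφ : Measurable (({0} : Set ℝ≥0∞).indicator (1 : ℝ≥0∞ → ℝ≥0∞)) :=
    measurable_one.indicator (measurableSet_singleton 0)
  rw [← lintegral_indicator hset]
  have h1 : ∀ ω, {ω | η ω S' = 0}.indicator (fun ω => η ω S) ω =
      ((fun ω => η ω S) * ((({0} : Set ℝ≥0∞).indicator (1 : ℝ≥0∞ → ℝ≥0∞)) ∘ fun ω => η ω S') :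
        Ω → ℝ≥0∞) ω := by
    intro ω
    by_cases h : η ω S' = 0 <;> simp [h, indicator]
  simp_rw [h1]
  rw [lintegral_mul_eq_lintegral_mul_lintegral_of_indepFun hm
    (hφ.comp (hη.measurable_count hS')) (hind.comp measurable_id hφ),
    hη.lintegral_count hS hfin, ← hη.measure_count_eq_zero hS' hfin']
  congr 1
  rw [← lintegral_indicator_one hset]
  rfl

end IsPoissonProcess

end Poisson

/-! ### Counting measures and random measures -/

/-- A kernel whose measures are all finite on each of countably many covering sets is s-finite. The
masses of such a set need not be bounded uniformly in `ω`, but they are on each of the countably many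
events that fix the integer part of the mass. -/
theorem isSFiniteKernel_of_measure_ne_top {Ω X : Type*} [MeasurableSpace Ω] [MeasurableSpace X]
    (κ : Kernel Ω X) {K : ℕ → Set X} (hK : ∀ n, MeasurableSet (K n)) (hU : ⋃ n, K n = univ)
    (hfin : ∀ ω n, κ ω (K n) ≠ ∞) : IsSFiniteKernel κ := by
  classical
  have hD : ∀ n, MeasurableSet (disjointed K n) := fun n => .disjointed hK n
  let f : ℕ → Ω → ℕ := fun n ω => ⌊(κ ω (disjointed K n)).toNNReal⌋₊
  have hf : ∀ n, Measurable (f n) := fun n =>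
    Nat.measurable_floor.comp (κ.measurable_coe (hD n)).ennreal_toNNReal
  have hs : ∀ n j, MeasurableSet (f n ⁻¹' {j}) := fun n j => hf n (measurableSet_singleton j)
  have hfin' : ∀ n ω, κ ω (disjointed K n) ≠ ∞ := fun n ω =>
    ne_top_of_le_ne_top (hfin ω n) (measure_mono (disjointed_subset K n))
  let κ' : ℕ → ℕ → Kernel Ω X := fun n j =>
    Kernel.piecewise (hs n j) (κ.restrict (hD n)) 0
  have hκ' : ∀ n j, IsFiniteKernel (κ' n j) := by
    intro n j
    refine ⟨⟨j + 1, by finiteness, fun ω => ?_⟩⟩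
    simp only [κ', Kernel.piecewise_apply]
    split_ifs with h
    · rw [Kernel.restrict_apply, Measure.restrict_apply_univ]
      have h1 := Nat.lt_floor_add_one (κ ω (disjointed K n)).toNNReal
      have h2 : ⌊(κ ω (disjointed K n)).toNNReal⌋₊ = j := h
      rw [h2] at h1
      rw [← ENNReal.coe_toNNReal (hfin' n ω)]
      exact_mod_cast h1.le
    · simp
  have hsum : κ = Kernel.sum fun n => Kernel.sum (κ' n) := by
    ext ω s hsm
    rw [Kernel.sum_apply' _ _ hsm]
    have : ∀ n, Kernel.sum (κ' n) ω s = κ ω (s ∩ disjointed K n) := by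
      intro n
      rw [Kernel.sum_apply' _ _ hsm, tsum_eq_single (f n ω)]
      · simp [κ', Kernel.piecewise_apply, Kernel.restrict_apply, Measure.restrict_apply hsm]
      · intro j hj
        have : ω ∉ f n ⁻¹' {j} := fun h => hj h.symm
        simp only [κ', Kernel.piecewise_apply, if_neg this]
        simp
    simp_rw [this]
    rw [← measure_iUnion (fun i j hij => ((disjoint_disjointed K) hij).mono
      inter_subset_right inter_subset_right) (fun n => hsm.inter (hD n)), ← inter_iUnion,
      iUnion_disjointed, hU, inter_univ]
  rw [hsum]
  infer_instance

/-- A set of positive finite mass for an integer-valued measure contains an atom: a subset of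
least positive mass has only subsets of zero or full mass, and a countable separating family then
cuts it down to a point. -/
theorem exists_measure_singleton_ne_zero {X : Type*} [MeasurableSpace X]
    [MeasurableSpace.CountablySeparated X] {μ : Measure X}
    (hμ : ∀ B : Set X, MeasurableSet B → ∃ n : ℕ∞, μ B = (n : ℝ≥0∞))
    {B : Set X} (hB : MeasurableSet B) (hfin : μ B ≠ ∞) (hpos : μ B ≠ 0) :
    ∃ x ∈ B, μ {x} ≠ 0 := by
  classical
  have hμ' : ∀ C : Set X, MeasurableSet C → C ⊆ B → ∃ n : ℕ, μ C = n := by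
    intro C hC hCB
    obtain ⟨n, hn⟩ := hμ C hC
    have : (n : ℝ≥0∞) ≠ ∞ := hn ▸ ne_top_of_le_ne_top hfin (measure_mono hCB)
    lift n to ℕ using by simpa using this
    exact ⟨n, by simpa using hn⟩
  let p : ℕ → Prop := fun n => n ≠ 0 ∧ ∃ C, MeasurableSet C ∧ C ⊆ B ∧ μ C = n
  have hp : ∃ n, p n := by
    obtain ⟨n, hn⟩ := hμ' B hB subset_rfl
    exact ⟨n, by rintro rfl; simp_all, B, hB, subset_rfl, hn⟩
  obtain ⟨hn0, C, hC, hCB, hCn⟩ := Nat.find_spec hp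
  set n := Nat.find hp
  have hCfin : μ C ≠ ∞ := by rw [hCn]; simp
  have hdich : ∀ D, MeasurableSet D → μ (C ∩ D) = 0 ∨ μ (C \ D) = 0 := by
    intro D hD
    by_contra! h
    obtain ⟨k, hk⟩ := hμ' (C ∩ D) (hC.inter hD) (inter_subset_left.trans hCB)
    obtain ⟨l, hl⟩ := hμ' (C \ D) (hC.diff hD) (sdiff_subset.trans hCB)
    have h1 : n ≤ k := Nat.find_min' hp
      ⟨by rintro rfl; simp_all, _, hC.inter hD, inter_subset_left.trans hCB, hk⟩
    have hl0 : l ≠ 0 := by rintro rfl; simp_all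
    have h2 : k + l = n := by
      have := measure_inter_add_sdiff (μ := μ) C hD
      rw [hk, hl, hCn] at this
      exact_mod_cast this
    omega
  have hsep := Filter.exists_subsingleton_mem_of_forall_separating
    (l := ae (μ.restrict C)) MeasurableSet (fun D hD => by
      rw [mem_ae_iff, mem_ae_iff, Measure.restrict_apply hD.compl, compl_compl,
        Measure.restrict_apply hD, inter_comm, inter_comm D, ← sdiff_eq]
      exact (hdich D hD).symm)
  obtain ⟨s, hs, hmem⟩ := hsep
  rw [mem_ae_iff, Measure.restrict_apply' hC] at hmem
  have hsC : μ (C ∩ s) ≠ 0 := by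
    intro h
    have : μ C ≤ μ (C ∩ s) + μ (sᶜ ∩ C) := by
      refine (measure_mono ?_).trans (measure_union_le _ _)
      intro x hx
      by_cases h : x ∈ s
      · exact .inl ⟨hx, h⟩
      · exact .inr ⟨h, hx⟩
    rw [h, hmem, hCn] at this
    simp_all
  obtain ⟨x, hxC, hxs⟩ := nonempty_of_measure_ne_zero hsC
  refine ⟨x, hCB hxC, fun h => hsC (measure_mono_null ?_ h)⟩
  exact fun y hy => hs hy.2 hxs

/-! ### Points of a Poisson process that minimize a function -/

theorem setLIntegral_eq_tsum_fiber {X : Type*} [MeasurableSpace X] (μ : Measure X) {g : X → ℤ}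
    (hg : Measurable g) {B : Set X} (hB : MeasurableSet B) (f : X → ℝ≥0∞) :
    ∫⁻ x in B, f x ∂μ = ∑' k : ℤ, ∫⁻ x in B ∩ g ⁻¹' {k}, f x ∂μ := by
  rw [← lintegral_iUnion (fun k => hB.inter (hg (measurableSet_singleton k))), ← inter_iUnion,
    ← preimage_iUnion, iUnion_of_singleton, preimage_univ, inter_univ]
  intro i j hij
  exact (Disjoint.preimage g (by simpa using hij)).mono inter_subset_right inter_subset_right

theorem measure_eq_tsum_fiber {X : Type*} [MeasurableSpace X] (μ : Measure X) {g : X → ℤ}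
    (hg : Measurable g) {B : Set X} (hB : MeasurableSet B) :
    μ B = ∑' k : ℤ, μ (B ∩ g ⁻¹' {k}) := by
  simpa using setLIntegral_eq_tsum_fiber μ hg hB 1

/-- The largest multiple of `2⁻ᵐ` that is at most `x`. -/
noncomputable def dyadicFloor (m : ℕ) (x : ℝ) : ℝ := ⌊x * 2 ^ m⌋ / 2 ^ m

theorem measurable_dyadicFloor (m : ℕ) : Measurable (dyadicFloor m) := by
  have : Measurable fun x : ℝ => ((⌊x * 2 ^ m⌋ : ℤ) : ℝ) :=
    (measurable_of_countable (fun k : ℤ => (k : ℝ))).comp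
      (Int.measurable_floor.comp (measurable_id.mul_const _))
  exact this.div_const _

theorem dyadicFloor_le (m : ℕ) (x : ℝ) : dyadicFloor m x ≤ x := by
  rw [dyadicFloor, div_le_iff₀ (by positivity)]
  exact Int.floor_le _

theorem monotone_dyadicFloor (x : ℝ) : Monotone fun m => dyadicFloor m x := by
  refine monotone_nat_of_le_succ fun m => ?_
  rw [dyadicFloor, dyadicFloor, div_le_div_iff₀ (by positivity) (by positivity)]
  have h : 2 * ⌊x * 2 ^ m⌋ ≤ ⌊x * 2 ^ (m + 1)⌋ := by
    rw [Int.le_floor]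
    push_cast
    have := Int.floor_le (x * 2 ^ m)
    rw [pow_succ]
    linarith
  have h' : (2 : ℝ) * ⌊x * 2 ^ m⌋ ≤ ⌊x * 2 ^ (m + 1)⌋ := by exact_mod_cast h
  have h'' := mul_le_mul_of_nonneg_right h' (show (0 : ℝ) ≤ 2 ^ m by positivity)
  calc (⌊x * 2 ^ m⌋ : ℝ) * 2 ^ (m + 1) = 2 * ⌊x * 2 ^ m⌋ * 2 ^ m := by ring
    _ ≤ _ := h''

theorem exists_lt_dyadicFloor {x y : ℝ} (h : y < x) : ∃ m, y < dyadicFloor m x := by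
  obtain ⟨m, hm⟩ := exists_pow_lt_of_lt_one (sub_pos.2 h) (by norm_num : (1 / 2 : ℝ) < 1)
  refine ⟨m, ?_⟩
  rw [dyadicFloor, lt_div_iff₀ (by positivity)]
  have h1 := Int.lt_floor_add_one (x * 2 ^ m)
  have h2 : (1 / 2 : ℝ) ^ m * 2 ^ m = 1 := by rw [← mul_pow]; norm_num
  nlinarith [show (0 : ℝ) < 2 ^ m by positivity]

theorem iUnion_setOf_lt_dyadicFloor {X : Type*} (T : X → ℝ) (x : ℝ) :
    ⋃ m, {q | T q < dyadicFloor m x} = {q | T q < x} := by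
  ext q
  simp only [mem_iUnion, mem_ofPred_eq]
  exact ⟨fun ⟨m, hm⟩ => hm.trans_le (dyadicFloor_le m x), exists_lt_dyadicFloor⟩

theorem monotone_setOf_lt_dyadicFloor {X : Type*} (T : X → ℝ) (x : ℝ) :
    Monotone fun m => {q | T q < dyadicFloor m x} :=
  fun _ _ h _ hq => lt_of_lt_of_le hq (monotone_dyadicFloor x h)

/-- The probability `exp(-m)` that a Poisson variable of mean `m < ∞` vanishes, as an extended
nonnegative real; the value at `m = ∞` is not meaningful. -/
noncomputable def voidProb (m : ℝ≥0∞) : ℝ≥0∞ := ENNReal.ofReal (Real.exp (-m.toReal))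

theorem measurable_voidProb : Measurable voidProb := by
  unfold voidProb; fun_prop

theorem voidProb_le_one (m : ℝ≥0∞) : voidProb m ≤ 1 := by
  simp [voidProb]

section

variable {Ω X : Type*} [MeasurableSpace Ω] [MeasurableSpace X]

theorem measurable_measure_setOf_lt (κ : Kernel Ω X) [IsSFiniteKernel κ] {T c : X → ℝ}
    (hT : Measurable T) (hc : Measurable c) :
    Measurable fun a : Ω × X => κ a.1 {q | T q < c a.2} := by
  have ht : MeasurableSet {a : (Ω × X) × X | T a.2 < c a.1.2} :=
    measurableSet_lt (hT.comp measurable_snd) (hc.comp (measurable_snd.comp measurable_fst))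
  exact Kernel.measurable_kernel_prodMk_left (κ := κ.comap Prod.fst measurable_fst) ht

theorem measurable_measure_setOf_lt' (Λ : Measure X) [SFinite Λ] {T c : X → ℝ}
    (hT : Measurable T) (hc : Measurable c) :
    Measurable fun a : X => Λ {q | T q < c a} :=
  measurable_measure_prodMk_left (s := {a : X × X | T a.2 < c a.1})
    (measurableSet_lt (hT.comp measurable_snd) (hc.comp measurable_fst))

variable [Bornology X] {P : Measure Ω} {Λ : Measure X}

namespace IsPoissonProcess

/-- With `T p` rounded down to the dyadic grid, the points of each layer between neighbouring grid
values are independent of the part of the process below the layer. -/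
theorem lintegral_measure_lowest_dyadic {κ : Kernel Ω X} (hη : IsPoissonProcess P κ Λ)
    [IsSFiniteKernel κ] {T : X → ℝ} (hT : Measurable T)
    (hfin : ∀ r, Λ {q | T q < r} ≠ ∞) {B : Set X} (hB : MeasurableSet B) (hBfin : Λ B ≠ ∞)
    (m : ℕ) :
    ∫⁻ ω, κ ω {p ∈ B | κ ω {q | T q < dyadicFloor m (T p)} = 0} ∂P =
      ∫⁻ p in B, voidProb (Λ {q | T q < dyadicFloor m (T p)}) ∂Λ := by
  let g : X → ℤ := fun p => ⌊T p * 2 ^ m⌋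
  have hg : Measurable g := Int.measurable_floor.comp (hT.mul_const _)
  have hlt : ∀ r, MeasurableSet {q | T q < r} := fun r => measurableSet_lt hT measurable_const
  have hBk : ∀ k, MeasurableSet (B ∩ g ⁻¹' {k}) := fun k =>
    hB.inter (hg (measurableSet_singleton k))
  have hset : ∀ k : ℤ, MeasurableSet {ω | κ ω {q | T q < k / 2 ^ m} = 0} := fun k =>
    hη.measurable_count (hlt _) (measurableSet_singleton 0)
  have hE : MeasurableSet {a : Ω × X | a.2 ∈ B ∧ κ a.1 {q | T q < dyadicFloor m (T a.2)} = 0} :=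
    (measurable_snd hB).inter (measurable_measure_setOf_lt κ hT
      ((measurable_dyadicFloor m).comp hT) (measurableSet_singleton 0))
  have hc : ∀ k : ℤ, ∀ p, g p = k → dyadicFloor m (T p) = k / 2 ^ m := by
    rintro k p rfl; rfl
  have h1 : ∀ ω, κ ω {p ∈ B | κ ω {q | T q < dyadicFloor m (T p)} = 0} =
      ∑' k : ℤ, {ω | κ ω {q | T q < k / 2 ^ m} = 0}.indicator
        (fun ω => κ ω (B ∩ g ⁻¹' {k})) ω := by
    intro ω
    have hEω : MeasurableSet {p ∈ B | κ ω {q | T q < dyadicFloor m (T p)} = 0} :=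
      measurable_prodMk_left (x := ω) hE
    rw [measure_eq_tsum_fiber (κ ω) hg hEω]
    congr 1 with k
    by_cases h : κ ω {q | T q < k / 2 ^ m} = 0
    · rw [indicator_of_mem (by exact h)]
      congr 1 with p
      constructor
      · rintro ⟨⟨hp, -⟩, hk⟩; exact ⟨hp, hk⟩
      · rintro ⟨hp, hk⟩
        refine ⟨⟨hp, ?_⟩, hk⟩
        simpa only [hc k p hk] using h
    · rw [indicator_of_notMem (by exact h)]
      convert measure_empty (μ := κ ω)
      ext p
      simp only [mem_inter_iff, mem_empty_iff_false, iff_false, not_and]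
      rintro ⟨-, hp⟩ hk
      simp only [hc k p hk] at hp
      exact h hp
  simp_rw [h1]
  rw [lintegral_tsum fun k =>
    ((hη.measurable_count (hBk k)).indicator (hset k)).aemeasurable,
    setLIntegral_eq_tsum_fiber Λ hg hB]
  congr 1 with k
  rw [lintegral_indicator (hset k), hη.setLIntegral_count (hBk k) (hlt _) _
    (ne_top_of_le_ne_top hBfin (measure_mono inter_subset_left)) (hfin _)]
  · rw [setLIntegral_congr_fun (g := fun _ => voidProb (Λ {q | T q < k / 2 ^ m})) (hBk k)
      (fun p hp => by simp only [hc k p hp.2]), setLIntegral_const, mul_comm]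
    rfl
  · rw [Set.disjoint_left]
    rintro p ⟨-, hp⟩ hlt
    have := dyadicFloor_le m (T p)
    rw [hc k p hp] at this
    exact absurd hlt (not_lt.2 this)

/-- The case of finite intensity of `IsPoissonProcess.lintegral_measure_lowest`: finiteness is what
lets the dyadic approximations, which decrease, converge. -/
theorem lintegral_measure_lowest_of_ne_top {κ : Kernel Ω X} (hη : IsPoissonProcess P κ Λ)
    [SFinite P] [SFinite Λ] [IsSFiniteKernel κ] {T : X → ℝ} (hT : Measurable T)
    (hfin : ∀ r, Λ {q | T q < r} ≠ ∞) {B : Set X} (hB : MeasurableSet B) (hBfin : Λ B ≠ ∞) :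
    ∫⁻ ω, κ ω {p ∈ B | κ ω {q | T q < T p} = 0} ∂P =
      ∫⁻ p in B, voidProb (Λ {q | T q < T p}) ∂Λ := by
  let E : ℕ → Set (Ω × X) := fun m =>
    {a : Ω × X | a.2 ∈ B ∧ κ a.1 {q | T q < dyadicFloor m (T a.2)} = 0}
  have hE : ∀ m, MeasurableSet (E m) := fun m =>
    (measurable_snd hB).inter (measurable_measure_setOf_lt κ hT
      ((measurable_dyadicFloor m).comp hT) (measurableSet_singleton 0))
  have hE' : MeasurableSet {a : Ω × X | a.2 ∈ B ∧ κ a.1 {q | T q < T a.2} = 0} :=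
    (measurable_snd hB).inter (measurable_measure_setOf_lt κ hT hT (measurableSet_singleton 0))
  have hanti : Antitone E := fun m n h a ha =>
    ⟨ha.1, measure_mono_null (monotone_setOf_lt_dyadicFloor T (T a.2) h) ha.2⟩
  have hinter : ⋂ m, E m = {a : Ω × X | a.2 ∈ B ∧ κ a.1 {q | T q < T a.2} = 0} := by
    ext a
    simp only [mem_iInter, E, mem_ofPred_eq]
    rw [forall_and, ← measure_iUnion_null_iff, iUnion_setOf_lt_dyadicFloor]
    simp
  have hlim := tendsto_measure_iInter_atTop (μ := P ⊗ₘ κ) (fun m => (hE m).nullMeasurableSet)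
    hanti ⟨0, by
      refine ne_top_of_le_ne_top (hη.lintegral_count hB hBfin ▸ hBfin) ?_
      rw [Measure.compProd_apply (hE 0)]
      exact lintegral_mono fun ω => measure_mono fun p hp => hp.1⟩
  rw [hinter, Measure.compProd_apply hE'] at hlim
  have hlim' : Tendsto (fun m => ∫⁻ p in B, voidProb (Λ {q | T q < dyadicFloor m (T p)}) ∂Λ)
      atTop (𝓝 (∫⁻ p in B, voidProb (Λ {q | T q < T p}) ∂Λ)) := by
    refine tendsto_lintegral_of_dominated_convergence 1 (fun m => measurable_voidProb.comp
      (measurable_measure_setOf_lt' Λ hT ((measurable_dyadicFloor m).comp hT)))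
      (fun m => ae_of_all _ fun p => voidProb_le_one _) (by simpa using hBfin)
      (ae_of_all _ fun p => ?_)
    have h := tendsto_measure_iUnion_atTop (μ := Λ) (monotone_setOf_lt_dyadicFloor T (T p))
    rw [iUnion_setOf_lt_dyadicFloor] at h
    exact ENNReal.tendsto_ofReal ((Real.continuous_exp.tendsto _).comp
      ((ENNReal.tendsto_toReal (hfin _)).comp h).neg)
  refine tendsto_nhds_unique hlim ?_
  convert hlim' using 2 with m
  rw [← hη.lintegral_measure_lowest_dyadic hT hfin hB hBfin m]
  exact Measure.compProd_apply (hE m)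

/-- The mean number of points of a Poisson process in `B` at which `T` is minimal among all points
is `∫_B exp(-Λ{T < T p}) Λ(dp)`. -/
theorem lintegral_measure_lowest {κ : Kernel Ω X} (hη : IsPoissonProcess P κ Λ)
    [SFinite P] [SFinite Λ] [IsSFiniteKernel κ] {T : X → ℝ} (hT : Measurable T)
    (hfin : ∀ r, Λ {q | T q < r} ≠ ∞) {B : Set X} (hB : MeasurableSet B) :
    ∫⁻ ω, κ ω {p ∈ B | κ ω {q | T q < T p} = 0} ∂P =
      ∫⁻ p in B, voidProb (Λ {q | T q < T p}) ∂Λ := by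
  -- On each of the sets `k ≤ T < k + 1` the intensity is finite.
  let g : X → ℤ := fun p => ⌊T p⌋
  have hg : Measurable g := Int.measurable_floor.comp hT
  have hE : ∀ C, MeasurableSet C →
      MeasurableSet {a : Ω × X | a.2 ∈ C ∧ κ a.1 {q | T q < T a.2} = 0} := fun C hC =>
    (measurable_snd hC).inter (measurable_measure_setOf_lt κ hT hT (measurableSet_singleton 0))
  have hBk : ∀ k, MeasurableSet (B ∩ g ⁻¹' {k}) := fun k =>
    hB.inter (hg (measurableSet_singleton k))
  have h1 : ∀ ω, κ ω {p ∈ B | κ ω {q | T q < T p} = 0} =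
      ∑' k : ℤ, κ ω {p ∈ B ∩ g ⁻¹' {k} | κ ω {q | T q < T p} = 0} := by
    intro ω
    have hEω : MeasurableSet {p ∈ B | κ ω {q | T q < T p} = 0} :=
      measurable_prodMk_left (x := ω) (hE B hB)
    rw [measure_eq_tsum_fiber (κ ω) hg hEω]
    congr 1 with k
    congr 1 with p
    simp only [mem_inter_iff, mem_preimage, mem_ofPred_eq, mem_singleton_iff]
    tauto
  have h2 : ∀ k, Measurable fun ω => κ ω {p ∈ B ∩ g ⁻¹' {k} | κ ω {q | T q < T p} = 0} :=
    fun k => Kernel.measurable_kernel_prodMk_left (κ := κ) (hE _ (hBk k))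
  simp_rw [h1]
  rw [lintegral_tsum fun k => (h2 k).aemeasurable, setLIntegral_eq_tsum_fiber Λ hg hB]
  congr 1 with k
  refine hη.lintegral_measure_lowest_of_ne_top hT hfin (hBk k)
    (ne_top_of_le_ne_top (hfin (k + 1)) (measure_mono ?_))
  rintro p ⟨-, hp⟩
  have : ⌊T p⌋ = k := hp
  exact this ▸ Int.lt_floor_add_one (T p)

end IsPoissonProcess

end

/-! ### Balls and polar coordinates in terms of the squared norm -/

theorem omega_eq (d : ℕ) : omega d = d * kappa d := by
  rw [omega, Measure.toSphere_real_apply_univ, kappa, finrank_euclideanSpace_fin]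
  congr 1
  rw [measureReal_def, measureReal_def, Measure.addHaar_unitClosedBall_eq_addHaar_unitBall]

theorem kappa_pos (d : ℕ) : 0 < kappa d :=
  ENNReal.toReal_pos (Metric.measure_closedBall_pos volume 0 one_pos).ne'
    measure_closedBall_lt_top.ne

theorem omega_nonneg (d : ℕ) : 0 ≤ omega d := measureReal_nonneg

theorem ofReal_kappa (d : ℕ) :
    ENNReal.ofReal (kappa d) = volume (Metric.ball (0 : EuclideanSpace ℝ (Fin d)) 1) := by
  rw [kappa, ofReal_measureReal measure_closedBall_lt_top.ne,
    Measure.addHaar_unitClosedBall_eq_addHaar_unitBall]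

theorem volume_setOf_norm_sq_lt {d : ℕ} {s : ℝ} (hs : 0 < s) :
    volume {y : EuclideanSpace ℝ (Fin d) | ‖y‖ ^ 2 < s} =
      ENNReal.ofReal (kappa d * s ^ ((d : ℝ) / 2)) := by
  have h : {y : EuclideanSpace ℝ (Fin d) | ‖y‖ ^ 2 < s} = Metric.ball 0 (√s) := by
    ext y
    simp [Real.lt_sqrt (norm_nonneg y)]
  rw [h, Measure.addHaar_ball_of_pos _ _ (Real.sqrt_pos.2 hs), ← ofReal_kappa,
    ← ENNReal.ofReal_mul (by positivity), finrank_euclideanSpace_fin, mul_comm,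
    Real.sqrt_eq_rpow, ← Real.rpow_natCast, ← Real.rpow_mul hs.le]
  congr 3
  ring

theorem volume_setOf_norm_sq_lt_of_nonpos {d : ℕ} {s : ℝ} (hs : s ≤ 0) :
    volume {y : EuclideanSpace ℝ (Fin d) | ‖y‖ ^ 2 < s} = 0 := by
  convert measure_empty (μ := volume)
  ext y
  simp only [mem_ofPred_eq, mem_empty_iff_false, iff_false, not_lt]
  exact hs.trans (by positivity)

theorem setLIntegral_Ioc_rpow {a s : ℝ} (ha : 0 ≤ a) (hs : 0 ≤ s) :
    ∫⁻ r in Ioc 0 s, ENNReal.ofReal (r ^ a) = ENNReal.ofReal (s ^ (a + 1) / (a + 1)) := by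
  have hint : IntervalIntegrable (fun r : ℝ => r ^ a) volume 0 s :=
    intervalIntegral.intervalIntegrable_rpow' (by linarith)
  rw [← ofReal_integral_eq_lintegral_ofReal
    ((intervalIntegrable_iff_integrableOn_Ioc_of_le hs).1 hint)
    ((ae_restrict_mem measurableSet_Ioc).mono fun r hr => Real.rpow_nonneg hr.1.le a),
    ← intervalIntegral.integral_of_le hs, integral_rpow (.inl (by linarith)),
    Real.zero_rpow (by linarith), sub_zero]

theorem lintegral_Ici_eq_Ioi_zero (h : ℝ) (f : ℝ → ℝ≥0∞) :
    ∫⁻ r in Ioi 0, f (r + h) = ∫⁻ u in Ici h, f u := by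
  rw [setLIntegral_congr (Ioi_ae_eq_Ici (a := (0 : ℝ))), ← lintegral_indicator measurableSet_Ici,
    ← lintegral_indicator measurableSet_Ici,
    ← lintegral_add_right_eq_self ((Ici h).indicator f) h]
  congr 1 with r
  by_cases hr : 0 ≤ r <;> simp [indicator, hr]

/-- The law of `‖y‖²` under Lebesgue measure has density `(ω_d / 2) r ^ (d/2 - 1)`. -/
theorem map_norm_sq_volume {d : ℕ} (hd : 2 ≤ d) :
    (volume : Measure (EuclideanSpace ℝ (Fin d))).map (fun y => ‖y‖ ^ 2) =
      (volume.restrict (Ioi (0 : ℝ))).withDensity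
        fun r => ENNReal.ofReal (omega d / 2 * r ^ ((d : ℝ) / 2 - 1)) := by
  have hd' : (2 : ℝ) ≤ d := by exact_mod_cast hd
  have hmeas : Measurable fun y : EuclideanSpace ℝ (Fin d) => ‖y‖ ^ 2 := by fun_prop
  set μ := (volume : Measure (EuclideanSpace ℝ (Fin d))).map (fun y => ‖y‖ ^ 2)
  set ν := (volume.restrict (Ioi (0 : ℝ))).withDensity
        fun r => ENNReal.ofReal (omega d / 2 * r ^ ((d : ℝ) / 2 - 1))
  have hμ : ∀ s, μ (Iio s) = volume {y : EuclideanSpace ℝ (Fin d) | ‖y‖ ^ 2 < s} := fun s =>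
    Measure.map_apply hmeas measurableSet_Iio
  have hνμ : ∀ s, μ (Iio s) = ν (Iio s) := by
    intro s
    rw [hμ, withDensity_apply _ measurableSet_Iio, Measure.restrict_restrict measurableSet_Iio,
      inter_comm, Ioi_inter_Iio]
    rcases le_or_gt s 0 with hs | hs
    · rw [volume_setOf_norm_sq_lt_of_nonpos hs, Ioo_eq_empty hs.not_gt]
      simp
    · rw [volume_setOf_norm_sq_lt hs, setLIntegral_congr Ioo_ae_eq_Ioc]
      simp_rw [ENNReal.ofReal_mul (div_nonneg (omega_nonneg d) zero_le_two)]
      rw [lintegral_const_mul' _ _ ENNReal.ofReal_ne_top,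
        setLIntegral_Ioc_rpow (by linarith) hs.le,
        ← ENNReal.ofReal_mul (div_nonneg (omega_nonneg d) zero_le_two), sub_add_cancel, omega_eq]
      congr 1
      field_simp
  have hfin : ∀ s, μ (Iio s) ≠ ∞ := by
    intro s
    rw [hμ]
    rcases le_or_gt s 0 with hs | hs
    · simp [volume_setOf_norm_sq_lt_of_nonpos hs]
    · simp [volume_setOf_norm_sq_lt hs]
  refine Measure.ext_of_Ico' μ ν (fun a b _ => ?_) fun a b _ => ?_
  · exact ne_top_of_le_ne_top (hfin b) (measure_mono Ico_subset_Iio_self)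
  · have hsd : Ico a b = Iio b \ Iio a := by ext; simp
    rcases le_total a b with h | h
    · rw [hsd, measure_sdiff (Iio_subset_Iio h) measurableSet_Iio.nullMeasurableSet (hfin a),
        measure_sdiff (Iio_subset_Iio h) measurableSet_Iio.nullMeasurableSet (hνμ a ▸ hfin a),
        hνμ, hνμ]
    · simp [Ico_eq_empty h.not_gt]

theorem lintegral_norm_sub_sq_add {d : ℕ} (hd : 2 ≤ d) (x : EuclideanSpace ℝ (Fin d)) (h : ℝ)
    {f : ℝ → ℝ≥0∞} (hf : Measurable f) :
    ∫⁻ y, f (‖y - x‖ ^ 2 + h) =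
      ∫⁻ u in Ici h, ENNReal.ofReal (omega d / 2 * (u - h) ^ ((d : ℝ) / 2 - 1)) * f u := by
  have hf' : Measurable fun r => f (r + h) := hf.comp (measurable_id.add_const h)
  rw [lintegral_sub_right_eq_self (fun y => f (‖y‖ ^ 2 + h)) x,
    ← lintegral_map (g := fun y : EuclideanSpace ℝ (Fin d) => ‖y‖ ^ 2) hf' (by fun_prop),
    map_norm_sq_volume hd, lintegral_withDensity_eq_lintegral_mul _ (by fun_prop) hf',
    ← lintegral_Ici_eq_Ioi_zero]
  simp

theorem integrableOn_sub_rpow (𝔽 : Measure ℝ) [IsLocallyFiniteMeasure 𝔽] {a z u : ℝ}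
    (ha : 0 ≤ a) (hz : z ≤ u) : IntegrableOn (fun t => (u - t) ^ a) (Ioc 0 z) 𝔽 := by
  refine Measure.integrableOn_of_bounded (M := u ^ a) measure_Ioc_lt_top.ne
    (by fun_prop) ((ae_restrict_mem measurableSet_Ioc).mono fun t ht => ?_)
  rw [Real.norm_of_nonneg (Real.rpow_nonneg (by linarith [ht.2]) a)]
  exact Real.rpow_le_rpow (by linarith [ht.2]) (by linarith [ht.1]) ha

/-- `cumWeight d 𝔽 u = κ_d ∫_{(0,u]} (u - t)^{d/2} 𝔽(dt)`, the mean number of points whose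
power with respect to a given site is below `u`. -/
noncomputable def cumWeight (d : ℕ) (𝔽 : Measure ℝ) (u : ℝ) : ℝ :=
  kappa d * ∫ t in Ioc 0 u, (u - t) ^ ((d : ℝ) / 2) ∂𝔽

theorem cumWeight_nonneg (d : ℕ) (𝔽 : Measure ℝ) (u : ℝ) : 0 ≤ cumWeight d 𝔽 u :=
  mul_nonneg (kappa_pos d).le (setIntegral_nonneg measurableSet_Ioc fun t ht =>
    Real.rpow_nonneg (by linarith [ht.2]) _)

theorem ofReal_cumWeight (d : ℕ) (𝔽 : Measure ℝ) [IsLocallyFiniteMeasure 𝔽] (u : ℝ) :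
    ENNReal.ofReal (cumWeight d 𝔽 u) =
      ∫⁻ t in Ioc 0 u, ENNReal.ofReal (kappa d * (u - t) ^ ((d : ℝ) / 2)) ∂𝔽 := by
  rw [cumWeight, ← integral_const_mul, ofReal_integral_eq_lintegral_ofReal]
  · exact (integrableOn_sub_rpow 𝔽 (by positivity) le_rfl).const_mul _
  · exact (ae_restrict_mem measurableSet_Ioc).mono fun t ht =>
      mul_nonneg (kappa_pos d).le (Real.rpow_nonneg (by linarith [ht.2]) _)

/-! ### The intensity of points of small power -/

/-- The power of the site `y` with respect to the weighted point `p`. -/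
noncomputable def power {d : ℕ} (y : EuclideanSpace ℝ (Fin d)) (p : WeightedPoint d) : ℝ :=
  ‖y - p.1‖ ^ 2 + p.2

theorem measurable_power_uncurry {d : ℕ} :
    Measurable fun a : EuclideanSpace ℝ (Fin d) × WeightedPoint d => power a.1 a.2 :=
  ((measurable_fst.sub measurable_snd.fst).norm.pow_const 2).add
    (measurable_subtype_coe.comp measurable_snd.snd)

theorem measurable_power {d : ℕ} (y : EuclideanSpace ℝ (Fin d)) : Measurable (power y) :=
  ((measurable_const.sub measurable_fst).norm.pow_const 2).add
    (measurable_subtype_coe.comp measurable_snd)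

instance sFinite_comap_subtype (𝔽 : Measure ℝ) [IsLocallyFiniteMeasure 𝔽] :
    SFinite (𝔽.comap (Subtype.val : Ioi (0 : ℝ) → ℝ)) := by
  have : IsLocallyFiniteMeasure (𝔽.comap (Subtype.val : Ioi (0 : ℝ) → ℝ)) := by
    refine ⟨fun x => ?_⟩
    obtain ⟨s, hs, hfin⟩ := 𝔽.finiteAt_nhds (x : ℝ)
    refine ⟨Subtype.val ⁻¹' s, continuous_subtype_val.continuousAt hs, ?_⟩
    rw [comap_subtype_coe_apply measurableSet_Ioi]
    exact (measure_mono (image_preimage_subset _ _)).trans_lt hfin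
  infer_instance

instance sFinite_intensity (d : ℕ) (𝔽 : Measure ℝ) [IsLocallyFiniteMeasure 𝔽] :
    SFinite (intensity d 𝔽) := by
  unfold intensity; infer_instance

/-- For fixed `t` the points `(x, t)` of power below `s` form the ball of squared radius `s - t`
around `y`. -/
theorem intensity_setOf_power_lt {d : ℕ} (hd : 2 ≤ d) (𝔽 : Measure ℝ) [IsLocallyFiniteMeasure 𝔽]
    (y : EuclideanSpace ℝ (Fin d)) (s : ℝ) :
    intensity d 𝔽 {q | power y q < s} = ENNReal.ofReal (cumWeight d 𝔽 s) := by
  have hd' : (2 : ℝ) ≤ d := by exact_mod_cast hd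
  have hball : ∀ t : ℝ, volume {x : EuclideanSpace ℝ (Fin d) | ‖y - x‖ ^ 2 + t < s} =
      volume {x : EuclideanSpace ℝ (Fin d) | ‖x‖ ^ 2 < s - t} := by
    intro t
    have hm : MeasurableSet {x : EuclideanSpace ℝ (Fin d) | ‖x‖ ^ 2 < s - t} :=
      measurableSet_lt (by fun_prop) (by fun_prop)
    rw [← (Measure.measurePreserving_sub_left volume y).measure_preimage hm.nullMeasurableSet]
    congr 1 with x
    simp [lt_sub_iff_add_lt]
  have hs : MeasurableSet {q : WeightedPoint d | power y q < s} :=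
    measurableSet_lt (measurable_power y) measurable_const
  rw [intensity, Measure.prod_apply_symm hs, ofReal_cumWeight]
  calc _ = ∫⁻ t : Ioi (0 : ℝ),
        volume {x : EuclideanSpace ℝ (Fin d) | ‖x‖ ^ 2 < s - t} ∂(𝔽.comap Subtype.val) := by
        congr 1 with t; exact hball t
    _ = ∫⁻ t in Ioi (0 : ℝ),
        volume {x : EuclideanSpace ℝ (Fin d) | ‖x‖ ^ 2 < s - t} ∂𝔽 :=
        lintegral_subtype_comap measurableSet_Ioi
          fun t => volume {x : EuclideanSpace ℝ (Fin d) | ‖x‖ ^ 2 < s - t}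
    _ = _ := by
        rw [← lintegral_indicator measurableSet_Ioi, ← lintegral_indicator measurableSet_Ioc]
        congr 1 with t
        by_cases ht : 0 < t
        · rw [indicator_of_mem (by exact ht)]
          rcases lt_trichotomy t s with h | h | h
          · rw [indicator_of_mem (by exact ⟨ht, h.le⟩), volume_setOf_norm_sq_lt (sub_pos.2 h)]
          · rw [indicator_of_mem (by exact ⟨ht, h.le⟩), h, sub_self,
              volume_setOf_norm_sq_lt_of_nonpos le_rfl, Real.zero_rpow (by linarith)]
            simp
          · rw [indicator_of_notMem (fun h' => h.not_ge h'.2),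
              volume_setOf_norm_sq_lt_of_nonpos (by linarith)]
        · rw [indicator_of_notMem (by exact ht), indicator_of_notMem (fun h' => ht h'.1)]

theorem volume_unitCube (d : ℕ) : volume (unitCube d) = 1 := by
  have h : unitCube d = (fun x : EuclideanSpace ℝ (Fin d) => (x.ofLp : Fin d → ℝ)) ⁻¹'
      Icc (0 : Fin d → ℝ) 1 := by
    ext x
    simp [unitCube, Pi.le_def, forall_and]
  rw [h, (PiLp.volume_preserving_ofLp (Fin d)).measure_preimage
    measurableSet_Icc.nullMeasurableSet, Real.volume_Icc_pi]
  simp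

theorem measurableSet_unitCube (d : ℕ) : MeasurableSet (unitCube d) := by
  have : unitCube d = ⋂ i, {x | x i ∈ Icc (0 : ℝ) 1} := by ext; simp [unitCube]
  rw [this]
  exact .iInter fun i => measurableSet_Icc.preimage (by fun_prop)

/-! ### The mean number of points of small power as a primitive -/

/-- `weightRate d 𝔽 u = (ω_d / 2) ∫_{(0,u]} (u - h)^{d/2-1} 𝔽(dh)`, the density of `cumWeight`. -/
noncomputable def weightRate (d : ℕ) (𝔽 : Measure ℝ) (u : ℝ) : ℝ :=
  omega d / 2 * ∫ h in Ioc 0 u, (u - h) ^ ((d : ℝ) / 2 - 1) ∂𝔽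

section

variable {d : ℕ} {𝔽 : Measure ℝ}

theorem weightRate_nonneg (u : ℝ) : 0 ≤ weightRate d 𝔽 u :=
  mul_nonneg (div_nonneg (omega_nonneg d) zero_le_two)
    (setIntegral_nonneg measurableSet_Ioc fun _ ht => Real.rpow_nonneg (by linarith [ht.2]) _)

variable [IsLocallyFiniteMeasure 𝔽]

theorem monotone_weightRate (hd : 2 ≤ d) : Monotone (weightRate d 𝔽) := by
  have hd' : (2 : ℝ) ≤ d := by exact_mod_cast hd
  intro u v huv
  refine mul_le_mul_of_nonneg_left ?_ (div_nonneg (omega_nonneg d) zero_le_two)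
  have hα : (0 : ℝ) ≤ d / 2 - 1 := by linarith
  calc ∫ h in Ioc 0 u, (u - h) ^ ((d : ℝ) / 2 - 1) ∂𝔽
      ≤ ∫ h in Ioc 0 u, (v - h) ^ ((d : ℝ) / 2 - 1) ∂𝔽 :=
        setIntegral_mono_on (integrableOn_sub_rpow 𝔽 hα le_rfl) (integrableOn_sub_rpow 𝔽 hα huv)
          measurableSet_Ioc fun h hh =>
            Real.rpow_le_rpow (by linarith [hh.2]) (by linarith) hα
    _ ≤ _ := setIntegral_mono_set (integrableOn_sub_rpow 𝔽 hα le_rfl)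
        ((ae_restrict_mem measurableSet_Ioc).mono fun h hh =>
          Real.rpow_nonneg (by linarith [hh.2]) _)
        (LE.le.eventuallyLE (Ioc_subset_Ioc_right huv))

theorem intervalIntegrable_weightRate (hd : 2 ≤ d) (a b : ℝ) :
    IntervalIntegrable (weightRate d 𝔽) volume a b :=
  (monotone_weightRate hd).intervalIntegrable

/-- In dimension two the rate is a multiple of the distribution function of `𝔽`, so no more than
right continuity can hold. -/
theorem continuousWithinAt_weightRate (hd : 2 ≤ d) (u : ℝ) :
    ContinuousWithinAt (weightRate d 𝔽) (Ioi u) u := by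
  have hd' : (2 : ℝ) ≤ d := by exact_mod_cast hd
  have hα : (0 : ℝ) ≤ d / 2 - 1 := by linarith
  refine tendsto_const_nhds.mul ?_
  simp_rw [← integral_indicator (measurableSet_Ioc (a := (0 : ℝ)))]
  have hbd : Integrable ((Ioc (0 : ℝ) (u + 1)).indicator
      fun _ => (u + 1) ^ ((d : ℝ) / 2 - 1)) 𝔽 :=
    (integrable_indicator_iff measurableSet_Ioc).2 (integrableOn_const measure_Ioc_lt_top.ne)
  refine tendsto_integral_filter_of_dominated_convergence _ ?_ ?_ hbd ?_
  · exact .of_forall fun v =>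
      (Measurable.indicator (by fun_prop) measurableSet_Ioc).aestronglyMeasurable
  · filter_upwards [Ioo_mem_nhdsGT (lt_add_one u)] with v hv
    refine ae_of_all _ fun h => ?_
    by_cases hh : h ∈ Ioc 0 v
    · rw [indicator_of_mem hh, indicator_of_mem (by exact ⟨hh.1, hh.2.trans hv.2.le⟩),
        Real.norm_of_nonneg (Real.rpow_nonneg (by linarith [hh.2]) _)]
      exact Real.rpow_le_rpow (by linarith [hh.2]) (by linarith [hh.1, hv.2]) hα
    · rw [indicator_of_notMem hh, norm_zero]
      exact indicator_nonneg (fun x hx => Real.rpow_nonneg (by linarith [hx.1, hx.2]) _) h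
  · refine ae_of_all _ fun h => ?_
    by_cases hh : h ∈ Ioc 0 u
    · rw [indicator_of_mem hh]
      have hc : Continuous fun v : ℝ => (v - h) ^ ((d : ℝ) / 2 - 1) :=
        (continuous_id.sub continuous_const).rpow_const fun _ => .inr hα
      refine ((hc.tendsto u).mono_left nhdsWithin_le_nhds).congr' ?_
      filter_upwards [self_mem_nhdsWithin] with v hv
      rw [indicator_of_mem (by exact ⟨hh.1, hh.2.trans (le_of_lt hv)⟩)]
    · rw [indicator_of_notMem hh]
      refine tendsto_const_nhds.congr' ?_
      by_cases h0 : 0 < h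
      · have hu : u < h := by by_contra! h'; exact hh ⟨h0, h'⟩
        filter_upwards [Ioo_mem_nhdsGT hu] with v hv
        rw [indicator_of_notMem fun h' => hv.2.not_ge h'.2]
      · exact .of_forall fun v => (indicator_of_notMem (fun h' => h0 h'.1) _).symm

theorem ofReal_weightRate (hd : 2 ≤ d) (u : ℝ) :
    ENNReal.ofReal (weightRate d 𝔽 u) =
      ∫⁻ h in Ioc 0 u, ENNReal.ofReal (omega d / 2 * (u - h) ^ ((d : ℝ) / 2 - 1)) ∂𝔽 := by
  have hd' : (2 : ℝ) ≤ d := by exact_mod_cast hd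
  rw [weightRate, ← integral_const_mul, ofReal_integral_eq_lintegral_ofReal]
  · exact (integrableOn_sub_rpow 𝔽 (by linarith) le_rfl).const_mul _
  · exact (ae_restrict_mem measurableSet_Ioc).mono fun t ht =>
      mul_nonneg (div_nonneg (omega_nonneg d) zero_le_two)
        (Real.rpow_nonneg (by linarith [ht.2]) _)

/-- Tonelli's theorem on the half plane `h ≤ u`. -/
theorem lintegral_lintegral_Ici_swap {f : ℝ → ℝ → ℝ≥0∞} (hf : Measurable (Function.uncurry f))
    (R s : Set ℝ) :
    ∫⁻ h in R, (∫⁻ u in s, (Ici h).indicator (f h) u) ∂𝔽 =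
      ∫⁻ u in s, ∫⁻ h in R ∩ Iic u, f h u ∂𝔽 := by
  have hm : Measurable (Function.uncurry fun h u : ℝ => (Ici h).indicator (f h) u) := by
    have : Function.uncurry (fun h u : ℝ => (Ici h).indicator (f h) u) =
        {p : ℝ × ℝ | p.1 ≤ p.2}.indicator (Function.uncurry f) := by
      ext ⟨h, u⟩
      simp [indicator, Function.uncurry]
    rw [this]
    exact hf.indicator (measurableSet_le measurable_fst measurable_snd)
  rw [lintegral_lintegral_swap hm.aemeasurable]
  congr 1 with u
  rw [inter_comm, ← Measure.restrict_restrict measurableSet_Iic,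
    ← lintegral_indicator measurableSet_Iic]
  congr 1 with h

theorem cumWeight_eq_integral (hd : 2 ≤ d) {z : ℝ} (hz : 0 ≤ z) :
    cumWeight d 𝔽 z = ∫ u in 0..z, weightRate d 𝔽 u := by
  have hd' : (2 : ℝ) ≤ d := by exact_mod_cast hd
  have hω : 0 ≤ omega d / 2 := div_nonneg (omega_nonneg d) zero_le_two
  have hint := (intervalIntegrable_iff_integrableOn_Ioc_of_le hz).1
    (intervalIntegrable_weightRate (𝔽 := 𝔽) hd 0 z)
  rw [intervalIntegral.integral_of_le hz]
  rw [← ENNReal.ofReal_eq_ofReal_iff (cumWeight_nonneg d 𝔽 z)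
    (integral_nonneg fun u => weightRate_nonneg u),
    ofReal_integral_eq_lintegral_ofReal hint (ae_of_all _ fun u => weightRate_nonneg u),
    ofReal_cumWeight]
  -- The antiderivative of `(ω_d / 2) (u - h)^{d/2-1}` in `u` is `κ_d (u - h)^{d/2}`, as `ω_d = d κ_d`.
  have hinner : ∀ h ∈ Ioc 0 z, ENNReal.ofReal (kappa d * (z - h) ^ ((d : ℝ) / 2)) =
      ∫⁻ u in Iic z, (Ici h).indicator
        (fun u => ENNReal.ofReal (omega d / 2 * (u - h) ^ ((d : ℝ) / 2 - 1))) u := by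
    intro h hh
    rw [lintegral_indicator measurableSet_Ici, Measure.restrict_restrict measurableSet_Ici,
      Ici_inter_Iic, setLIntegral_congr Ioc_ae_eq_Icc.symm]
    have hshift := (measurePreserving_sub_right volume h).setLIntegral_comp_preimage_emb
      (MeasurableEquiv.subRight h).measurableEmbedding
      (fun r => ENNReal.ofReal (omega d / 2 * r ^ ((d : ℝ) / 2 - 1))) (Ioc 0 (z - h))
    rw [preimage_sub_const_Ioc, zero_add, sub_add_cancel] at hshift
    rw [hshift]
    simp_rw [ENNReal.ofReal_mul hω]
    rw [lintegral_const_mul' _ _ ENNReal.ofReal_ne_top,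
      setLIntegral_Ioc_rpow (by linarith) (by linarith [hh.2]), ← ENNReal.ofReal_mul hω,
      sub_add_cancel, omega_eq]
    congr 1
    field_simp
  rw [setLIntegral_congr_fun measurableSet_Ioc hinner,
    lintegral_lintegral_Ici_swap
      (f := fun h u => ENNReal.ofReal (omega d / 2 * (u - h) ^ ((d : ℝ) / 2 - 1)))
      (by unfold Function.uncurry; fun_prop)]
  rw [← lintegral_indicator measurableSet_Iic, ← lintegral_indicator measurableSet_Ioc]
  congr 1 with u
  by_cases hu : u ∈ Ioc 0 z
  · rw [indicator_of_mem (by exact hu.2), indicator_of_mem hu, ofReal_weightRate hd]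
    have : Ioc 0 z ∩ Iic u = Ioc 0 u := by
      rw [Ioc_inter_Iic, min_eq_right hu.2]
    rw [this]
  · rw [indicator_of_notMem hu]
    by_cases huz : u ≤ z
    · have : Ioc 0 z ∩ Iic u = ∅ := by
        rw [Ioc_inter_Iic, min_eq_right huz]
        exact Ioc_eq_empty fun h => hu ⟨h, huz⟩
      rw [indicator_of_mem (by exact huz), this]
      simp
    · rw [indicator_of_notMem (by exact huz)]

/-- Fundamental theorem of calculus for `-exp (-cumWeight)`, whose right derivative is the
integrand. -/
theorem integral_exp_neg_cumWeight_mul (hd : 2 ≤ d) {z : ℝ} (hz : 0 ≤ z) :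
    IntervalIntegrable (fun u => Real.exp (-cumWeight d 𝔽 u) * weightRate d 𝔽 u) volume 0 z ∧
    ∫ u in 0..z, Real.exp (-cumWeight d 𝔽 u) * weightRate d 𝔽 u =
      1 - Real.exp (-cumWeight d 𝔽 z) := by
  have hint := intervalIntegrable_weightRate (𝔽 := 𝔽) hd
  have hcont : Continuous fun u => ∫ v in 0..u, weightRate d 𝔽 v :=
    intervalIntegral.continuous_primitive hint 0
  have heq : ∀ u ∈ uIcc 0 z, Real.exp (-∫ v in 0..u, weightRate d 𝔽 v) * weightRate d 𝔽 u =
      Real.exp (-cumWeight d 𝔽 u) * weightRate d 𝔽 u := by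
    intro u hu
    rw [uIcc_of_le hz] at hu
    rw [cumWeight_eq_integral hd hu.1]
  have hII : IntervalIntegrable
      (fun u => Real.exp (-∫ v in 0..u, weightRate d 𝔽 v) * weightRate d 𝔽 u) volume 0 z :=
    (hint 0 z).continuousOn_mul (Real.continuous_exp.comp hcont.neg).continuousOn
  refine ⟨hII.congr fun u hu => heq u (uIoc_subset_uIcc hu), ?_⟩
  rw [← intervalIntegral.integral_congr heq]
  have hderiv : ∀ x ∈ Ioo (min 0 z) (max 0 z), HasDerivWithinAt
      (fun u => -Real.exp (-∫ v in 0..u, weightRate d 𝔽 v))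
      (Real.exp (-∫ v in 0..x, weightRate d 𝔽 v) * weightRate d 𝔽 x) (Ioi x) x := by
    intro x _
    have h := intervalIntegral.integral_hasDerivWithinAt_right (hint 0 x)
      ((monotone_weightRate hd).measurable.stronglyMeasurable.stronglyMeasurableAtFilter)
      (continuousWithinAt_weightRate (𝔽 := 𝔽) hd x) (s := Ici x)
    have h2 := (h.mono Ioi_subset_Ici_self).neg.exp.neg
    exact h2.congr_deriv (by rw [mul_neg, neg_neg]; rfl)
  rw [intervalIntegral.integral_eq_sub_of_hasDeriv_right
    (Real.continuous_exp.comp hcont.neg).neg.continuousOn hderiv hII, cumWeight_eq_integral hd hz]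
  simp
  ring

theorem measurable_cumWeight : Measurable (cumWeight d 𝔽) := by
  have hs : MeasurableSet {p : ℝ × ℝ | p.2 ∈ Ioc 0 p.1} :=
    (measurableSet_lt measurable_const measurable_snd).inter
      (measurableSet_le measurable_snd measurable_fst)
  have hf : Measurable fun p : ℝ × ℝ => (p.1 - p.2) ^ ((d : ℝ) / 2) := by fun_prop
  have h : StronglyMeasurable fun u : ℝ => ∫ t, {p : ℝ × ℝ | p.2 ∈ Ioc 0 p.1}.indicator
      (fun p => (p.1 - p.2) ^ ((d : ℝ) / 2)) (u, t) ∂𝔽 :=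
    (hf.indicator hs).stronglyMeasurable.integral_prod_right'
  have : cumWeight d 𝔽 = fun u => kappa d * ∫ t, {p : ℝ × ℝ | p.2 ∈ Ioc 0 p.1}.indicator
      (fun p => (p.1 - p.2) ^ ((d : ℝ) / 2)) (u, t) ∂𝔽 := by
    ext u
    rw [cumWeight, ← integral_indicator measurableSet_Ioc]
    rfl
  rw [this]
  exact h.measurable.const_mul _

/-- Some interval `(0, M]` has positive mass `F(M)`, and `G(u) ≥ κ_d (u - M)^{d/2} F(M)`. -/
theorem tendsto_cumWeight_atTop (hd : 2 ≤ d) (h_pos : 𝔽 (Iic 0) = 0) (h_ne : 𝔽 ≠ 0) :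
    Tendsto (cumWeight d 𝔽) atTop atTop := by
  have hd' : (2 : ℝ) ≤ d := by exact_mod_cast hd
  obtain ⟨M, hM⟩ : ∃ n : ℕ, 𝔽 (Ioc 0 (n : ℝ)) ≠ 0 := by
    by_contra! h
    refine h_ne (Measure.measure_univ_eq_zero.1 ?_)
    have : (univ : Set ℝ) ⊆ Iic 0 ∪ ⋃ n : ℕ, Ioc 0 (n : ℝ) := by
      intro x _
      rcases le_or_gt x 0 with hx | hx
      · exact .inl hx
      · obtain ⟨n, hn⟩ := exists_nat_ge x
        exact .inr (mem_iUnion.2 ⟨n, hx, hn⟩)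
    exact measure_mono_null this (measure_union_null h_pos (measure_iUnion_null h))
  have hMpos : 0 < 𝔽.real (Ioc 0 (M : ℝ)) := ENNReal.toReal_pos hM measure_Ioc_lt_top.ne
  have hlim : Tendsto (fun u : ℝ => kappa d * ((u - M) ^ ((d : ℝ) / 2) * 𝔽.real (Ioc 0 (M : ℝ))))
      atTop atTop :=
    (((tendsto_rpow_atTop (by linarith)).comp
      (tendsto_atTop_add_const_right _ (-(M : ℝ)) tendsto_id)).atTop_mul_const hMpos).const_mul_atTop
      (kappa_pos d)
  refine tendsto_atTop_mono' _ ?_ hlim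
  filter_upwards [eventually_ge_atTop (M : ℝ)] with u hu
  refine mul_le_mul_of_nonneg_left ?_ (kappa_pos d).le
  calc (u - M) ^ ((d : ℝ) / 2) * 𝔽.real (Ioc 0 (M : ℝ))
      = ∫ t in Ioc 0 (M : ℝ), (u - M) ^ ((d : ℝ) / 2) ∂𝔽 := by
        rw [setIntegral_const, smul_eq_mul, mul_comm]
    _ ≤ ∫ t in Ioc 0 (M : ℝ), (u - t) ^ ((d : ℝ) / 2) ∂𝔽 :=
        setIntegral_mono_on (integrableOn_const measure_Ioc_lt_top.ne)
          (integrableOn_sub_rpow 𝔽 (by positivity) hu) measurableSet_Ioc fun t ht =>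
            Real.rpow_le_rpow (by linarith) (by linarith [ht.2]) (by positivity)
    _ ≤ _ := setIntegral_mono_set (integrableOn_sub_rpow 𝔽 (by positivity) le_rfl)
        ((ae_restrict_mem measurableSet_Ioc).mono fun h hh =>
          Real.rpow_nonneg (by linarith [hh.2]) _)
        (LE.le.eventuallyLE (Ioc_subset_Ioc_right hu))

end

/-! ### Laguerre cells and their volumes -/

theorem isBounded_closedBall_prod_Icc {d : ℕ} (y : EuclideanSpace ℝ (Fin d)) (r s : ℝ) :
    Bornology.IsBounded
      (Metric.closedBall y r ×ˢ (Subtype.val ⁻¹' Icc 0 s) : Set (WeightedPoint d)) :=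
  Metric.isBounded_closedBall.prod (Bornology.isBounded_image_subtype_val.1
    ((Metric.isBounded_Icc 0 s).subset (image_preimage_subset _ _)))

theorem isBounded_setOf_power_lt {d : ℕ} (y : EuclideanSpace ℝ (Fin d)) (s : ℝ) :
    Bornology.IsBounded {q : WeightedPoint d | power y q < s} := by
  refine (isBounded_closedBall_prod_Icc y (√s) s).subset fun q hq => ?_
  have hq' : ‖y - q.1‖ ^ 2 + q.2 < s := hq
  have hpos : 0 < (q.2 : ℝ) := q.2.2
  refine ⟨?_, hpos.le, by nlinarith [sq_nonneg ‖y - q.1‖]⟩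
  rw [Metric.mem_closedBall, dist_comm, dist_eq_norm]
  exact Real.le_sqrt_of_sq_le (by linarith)

theorem measurableSet_setOf_power_lt {d : ℕ} (y : EuclideanSpace ℝ (Fin d)) (s : ℝ) :
    MeasurableSet {q : WeightedPoint d | power y q < s} :=
  measurableSet_lt (measurable_power y) measurable_const

theorem mem_laguerreCell_pointsOf_iff {d : ℕ} {μ : Measure (WeightedPoint d)}
    (hμ : IsLocallyFiniteCounting μ) (p : WeightedPoint d) (y : EuclideanSpace ℝ (Fin d)) :
    y ∈ laguerreCell p (pointsOf μ) ↔ μ {q | power y q < power y p} = 0 := by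
  have hm := measurableSet_setOf_power_lt y (power y p)
  constructor
  · intro h
    by_contra hne
    obtain ⟨q, hq, hq'⟩ := exists_measure_singleton_ne_zero hμ.1 hm
      (hμ.2 _ hm (isBounded_setOf_power_lt y _)).ne hne
    exact absurd (h q hq') (not_le.2 hq)
  · intro h q hq
    by_contra! hlt
    exact hq (measure_mono_null (singleton_subset_iff.2 hlt) h)

theorem isSFiniteKernel_of_isLocallyFiniteCounting {Ω : Type*} [MeasurableSpace Ω] {d : ℕ}
    (κ : Kernel Ω (WeightedPoint d)) (hκ : ∀ ω, IsLocallyFiniteCounting (κ ω)) :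
    IsSFiniteKernel κ := by
  have hK : ∀ n : ℕ, MeasurableSet
      (Metric.closedBall 0 (n : ℝ) ×ˢ (Subtype.val ⁻¹' Icc 0 (n : ℝ)) : Set (WeightedPoint d)) :=
    fun n => Metric.isClosed_closedBall.measurableSet.prod (measurable_subtype_coe measurableSet_Icc)
  refine isSFiniteKernel_of_measure_ne_top κ hK ?_ fun ω n =>
    ((hκ ω).2 _ (hK n) (isBounded_closedBall_prod_Icc _ _ _)).ne
  refine eq_univ_of_forall fun q => ?_
  obtain ⟨n, hn⟩ := exists_nat_ge (max ‖q.1‖ q.2)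
  refine mem_iUnion.2 ⟨n, ?_, (q.2.2 : (0 : ℝ) < q.2).le, (le_max_right _ _).trans hn⟩
  simpa using (le_max_left _ _).trans hn

/-- The weighted points whose location lies in the unit cube and whose weight lies in `A`. -/
def cubePoints (d : ℕ) (A : Set ℝ) : Set (WeightedPoint d) :=
  unitCube d ×ˢ (Subtype.val ⁻¹' A)

theorem measurableSet_cubePoints (d : ℕ) {A : Set ℝ} (hA : MeasurableSet A) :
    MeasurableSet (cubePoints d A) :=
  (measurableSet_unitCube d).prod (measurable_subtype_coe hA)

section

variable {Ω : Type*} [MeasurableSpace Ω] {d : ℕ}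

theorem measurableSet_lowest (κ : Kernel Ω (WeightedPoint d)) [IsSFiniteKernel κ]
    {B : Set (WeightedPoint d)} (hB : MeasurableSet B) :
    MeasurableSet {a : (Ω × EuclideanSpace ℝ (Fin d)) × WeightedPoint d |
      a.2 ∈ B ∧ κ a.1.1 {q | power a.1.2 q < power a.1.2 a.2} = 0} := by
  have hp : Measurable fun b : ((Ω × EuclideanSpace ℝ (Fin d)) × WeightedPoint d) ×
      WeightedPoint d => power b.1.1.2 b.2 :=
    Measurable.comp (g := fun a : EuclideanSpace ℝ (Fin d) × WeightedPoint d => power a.1 a.2)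
      (f := fun b : ((Ω × EuclideanSpace ℝ (Fin d)) × WeightedPoint d) × WeightedPoint d =>
        (b.1.1.2, b.2)) measurable_power_uncurry
      ((measurable_fst.fst.snd).prodMk measurable_snd)
  have hp' : Measurable fun b : ((Ω × EuclideanSpace ℝ (Fin d)) × WeightedPoint d) ×
      WeightedPoint d => power b.1.1.2 b.1.2 :=
    Measurable.comp (g := fun a : EuclideanSpace ℝ (Fin d) × WeightedPoint d => power a.1 a.2)
      (f := fun b : ((Ω × EuclideanSpace ℝ (Fin d)) × WeightedPoint d) × WeightedPoint d =>
        (b.1.1.2, b.1.2)) measurable_power_uncurry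
      ((measurable_fst.fst.snd).prodMk measurable_fst.snd)
  have h := Kernel.measurable_kernel_prodMk_left
    (κ := κ.comap (fun a : (Ω × EuclideanSpace ℝ (Fin d)) × WeightedPoint d => a.1.1)
      measurable_fst.fst) (measurableSet_lt hp hp')
  exact (measurable_snd hB).inter (h (measurableSet_singleton 0))

/-- Integrating the volumes of the cells of the points in the cube counts, for each site `y`, the
points whose cell contains `y`. -/
theorem volumeBiasedSum_eq_lintegral (κ : Kernel Ω (WeightedPoint d))
    (hκ : ∀ ω, IsLocallyFiniteCounting (κ ω)) {A : Set ℝ} (hA : MeasurableSet A) (ω : Ω) :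
    volumeBiasedSum (κ ω) A =
      ∫⁻ y, κ ω {p ∈ cubePoints d A | κ ω {q | power y q < power y p} = 0} := by
  have := isSFiniteKernel_of_isLocallyFiniteCounting κ hκ
  let D : Set (EuclideanSpace ℝ (Fin d) × WeightedPoint d) :=
    {a | a.2 ∈ cubePoints d A ∧ κ ω {q | power a.1 q < power a.1 a.2} = 0}
  have hD : MeasurableSet D :=
    (measurable_const.prodMk measurable_fst |>.prodMk measurable_snd :
      Measurable fun a : EuclideanSpace ℝ (Fin d) × WeightedPoint d => ((ω, a.1), a.2))
      (measurableSet_lowest κ (measurableSet_cubePoints d hA))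
  have h1 := Measure.prod_apply (μ := (volume : Measure (EuclideanSpace ℝ (Fin d))))
    (ν := κ ω) hD
  have h2 := Measure.prod_apply_symm (μ := (volume : Measure (EuclideanSpace ℝ (Fin d))))
    (ν := κ ω) hD
  refine Eq.trans ?_ (h2.symm.trans h1)
  refine lintegral_congr fun p => ?_
  by_cases hp : p ∈ cubePoints d A
  · rw [indicator_of_mem hp.1, indicator_of_mem (by exact hp.2), Pi.one_apply, Pi.one_apply,
      one_mul, one_mul]
    congr 1 with y
    rw [mem_laguerreCell_pointsOf_iff (hκ ω)]
    exact ⟨fun h => ⟨hp, h⟩, fun h => h.2⟩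
  · have h0 : (fun x => (x, p)) ⁻¹' D = ∅ := by
      ext y
      exact ⟨fun h => hp h.1, fun h => h.elim⟩
    rw [h0, measure_empty]
    by_cases h1 : p.1 ∈ unitCube d
    · have h2 : (p.2 : ℝ) ∉ A := fun h2 => hp ⟨h1, h2⟩
      simp [h2]
    · simp [h1]

theorem measurable_lowest (κ : Kernel Ω (WeightedPoint d)) [IsSFiniteKernel κ]
    {B : Set (WeightedPoint d)} (hB : MeasurableSet B) :
    Measurable fun a : Ω × EuclideanSpace ℝ (Fin d) =>
      κ a.1 {p ∈ B | κ a.1 {q | power a.2 q < power a.2 p} = 0} :=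
  Kernel.measurable_kernel_prodMk_left (κ := κ.comap Prod.fst measurable_fst)
    (measurableSet_lowest κ hB)

theorem measurable_volumeBiasedSum (κ : Kernel Ω (WeightedPoint d))
    (hκ : ∀ ω, IsLocallyFiniteCounting (κ ω)) {A : Set ℝ} (hA : MeasurableSet A) :
    Measurable fun ω => volumeBiasedSum (κ ω) A := by
  have := isSFiniteKernel_of_isLocallyFiniteCounting κ hκ
  simp_rw [volumeBiasedSum_eq_lintegral κ hκ hA]
  exact (measurable_lowest κ (measurableSet_cubePoints d hA)).lintegral_prod_right'

end

/-! ### The volume-biased weight distribution -/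

/-- The density `h ↦ ∫_h^∞ (ω_d / 2) (u - h)^{d/2-1} exp(-G(u)) du`, with `G = cumWeight d 𝔽`, of
the volume-biased weight distribution with respect to `𝔽`; it is the mean volume of the Laguerre
cell of an added point of weight `h`. -/
noncomputable def weightDensity (d : ℕ) (𝔽 : Measure ℝ) (h : ℝ) : ℝ≥0∞ :=
  ∫⁻ u, (Ici h).indicator (fun u => ENNReal.ofReal (omega d / 2 * (u - h) ^ ((d : ℝ) / 2 - 1)) *
    ENNReal.ofReal (Real.exp (-cumWeight d 𝔽 u))) u

section

variable {d : ℕ} {𝔽 : Measure ℝ} [IsLocallyFiniteMeasure 𝔽]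

theorem measurable_weightDensity_integrand :
    Measurable (Function.uncurry fun h u : ℝ =>
      ENNReal.ofReal (omega d / 2 * (u - h) ^ ((d : ℝ) / 2 - 1)) *
        ENNReal.ofReal (Real.exp (-cumWeight d 𝔽 u))) := by
  have h1 : Measurable fun p : ℝ × ℝ =>
      ENNReal.ofReal (omega d / 2 * (p.2 - p.1) ^ ((d : ℝ) / 2 - 1)) := by fun_prop
  have h2 : Measurable fun p : ℝ × ℝ => ENNReal.ofReal (Real.exp (-cumWeight d 𝔽 p.2)) :=
    ((measurable_cumWeight.comp measurable_snd).neg.exp).ennreal_ofReal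
  exact h1.mul h2

theorem measurable_weightDensity : Measurable (weightDensity d 𝔽) := by
  have : Measurable ({p : ℝ × ℝ | p.1 ≤ p.2}.indicator (Function.uncurry fun h u : ℝ =>
      ENNReal.ofReal (omega d / 2 * (u - h) ^ ((d : ℝ) / 2 - 1)) *
        ENNReal.ofReal (Real.exp (-cumWeight d 𝔽 u)))) :=
    measurable_weightDensity_integrand.indicator (measurableSet_le measurable_fst measurable_snd)
  convert this.lintegral_prod_right' (ν := volume) using 2 with h
  rw [weightDensity]
  refine lintegral_congr fun u => ?_
  by_cases hu : h ≤ u <;> simp [indicator, hu]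

/-- The mean sum is the integral over the unit cube and `A` of the probability that the cell of an
added point covers `y`. -/
theorem volumeBiasedWeight_eq {Ω : Type*} [MeasurableSpace Ω] {P : Measure Ω}
    [IsProbabilityMeasure P] (hd : 2 ≤ d) (h_pos : 𝔽 (Iic 0) = 0)
    {κ : Kernel Ω (WeightedPoint d)} (hη : IsPoissonProcess P κ (intensity d 𝔽))
    {A : Set ℝ} (hA : MeasurableSet A) :
    volumeBiasedWeight P κ A = 𝔽.withDensity (weightDensity d 𝔽) A := by
  have := isSFiniteKernel_of_isLocallyFiniteCounting κ hη.counting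
  have hB := measurableSet_cubePoints d hA
  have hG : Measurable fun u => ENNReal.ofReal (Real.exp (-cumWeight d 𝔽 u)) :=
    measurable_cumWeight.neg.exp.ennreal_ofReal
  have hvoid : ∀ (y : EuclideanSpace ℝ (Fin d)) (s : ℝ),
      voidProb (intensity d 𝔽 {q | power y q < s}) =
        ENNReal.ofReal (Real.exp (-cumWeight d 𝔽 s)) := by
    intro y s
    rw [intensity_setOf_power_lt hd, voidProb, ENNReal.toReal_ofReal (cumWeight_nonneg d 𝔽 s)]
  have hinner : ∀ p : WeightedPoint d,
      ∫⁻ y, ENNReal.ofReal (Real.exp (-cumWeight d 𝔽 (power y p))) = weightDensity d 𝔽 p.2 := by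
    intro p
    rw [weightDensity, lintegral_indicator measurableSet_Ici]
    exact lintegral_norm_sub_sq_add hd p.1 p.2 hG
  calc volumeBiasedWeight P κ A
      = ∫⁻ ω, (∫⁻ y, κ ω {p ∈ cubePoints d A | κ ω {q | power y q < power y p} = 0}) ∂P :=
        lintegral_congr fun ω => volumeBiasedSum_eq_lintegral κ hη.counting hA ω
    _ = ∫⁻ y, ∫⁻ ω, κ ω {p ∈ cubePoints d A | κ ω {q | power y q < power y p} = 0} ∂P :=
        lintegral_lintegral_swap (measurable_lowest κ hB).aemeasurable
    _ = ∫⁻ y, ∫⁻ p in cubePoints d A,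
          ENNReal.ofReal (Real.exp (-cumWeight d 𝔽 (power y p))) ∂(intensity d 𝔽) := by
        refine lintegral_congr fun y => ?_
        rw [hη.lintegral_measure_lowest (measurable_power y) (fun r => by
          rw [intensity_setOf_power_lt hd]; exact ENNReal.ofReal_ne_top) hB]
        simp_rw [hvoid]
    _ = ∫⁻ p in cubePoints d A, (∫⁻ y,
          ENNReal.ofReal (Real.exp (-cumWeight d 𝔽 (power y p)))) ∂(intensity d 𝔽) :=
        lintegral_lintegral_swap (f := fun y p =>
          ENNReal.ofReal (Real.exp (-cumWeight d 𝔽 (power y p))))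
          (hG.comp measurable_power_uncurry).aemeasurable
    _ = ∫⁻ p in cubePoints d A, weightDensity d 𝔽 p.2 ∂(intensity d 𝔽) := by
        simp_rw [hinner]
    _ = ∫⁻ h in (Subtype.val ⁻¹' A : Set (Ioi (0 : ℝ))), weightDensity d 𝔽 h
          ∂(𝔽.comap Subtype.val) := by
        rw [cubePoints, intensity, ← Measure.prod_restrict, lintegral_prod_symm
          (fun p : WeightedPoint d => weightDensity d 𝔽 p.2)
          (measurable_weightDensity.comp
            (measurable_subtype_coe.comp measurable_snd)).aemeasurable]
        simp [volume_unitCube]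
    _ = _ := by
        rw [withDensity_apply _ hA, ← lintegral_indicator (measurable_subtype_coe hA)]
        have h := lintegral_subtype_comap (μ := 𝔽) (measurableSet_Ioi (a := (0 : ℝ)))
          (A.indicator (weightDensity d 𝔽))
        refine Eq.trans ?_ (h.trans ?_)
        · rfl
        · have : 𝔽.restrict (Ioi 0) = 𝔽 := by
            rw [Measure.restrict_eq_self_of_ae_mem]
            rw [ae_iff]
            convert h_pos using 2
            ext; simp
          rw [this, lintegral_indicator hA]

/-- The integral over the whole half line `u ≤ z`, on whose part `u ≤ 0` the rate vanishes. -/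
theorem setLIntegral_Iic_exp_neg_cumWeight (hd : 2 ≤ d) {z : ℝ} (hz : 0 ≤ z) :
    ∫⁻ u in Iic z, ENNReal.ofReal (Real.exp (-cumWeight d 𝔽 u) * weightRate d 𝔽 u) =
      ENNReal.ofReal (1 - Real.exp (-cumWeight d 𝔽 z)) := by
  obtain ⟨hint, heq⟩ := integral_exp_neg_cumWeight_mul (𝔽 := 𝔽) hd hz
  rw [← heq, intervalIntegral.integral_of_le hz, ofReal_integral_eq_lintegral_ofReal
    ((intervalIntegrable_iff_integrableOn_Ioc_of_le hz).1 hint)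
    (ae_of_all _ fun u => mul_nonneg (Real.exp_pos _).le (weightRate_nonneg u)),
    ← lintegral_indicator measurableSet_Iic, ← lintegral_indicator measurableSet_Ioc]
  congr 1 with u
  by_cases h0 : 0 < u
  · simp [indicator, h0]
  · have : weightRate d 𝔽 u = 0 := by simp [weightRate, Ioc_eq_empty h0]
    simp [indicator, this]

theorem withDensity_weightDensity_apply {R : Set ℝ} (hR : MeasurableSet R) :
    𝔽.withDensity (weightDensity d 𝔽) R = ∫⁻ u, ENNReal.ofReal (Real.exp (-cumWeight d 𝔽 u)) *
      ∫⁻ h in R ∩ Iic u, ENNReal.ofReal (omega d / 2 * (u - h) ^ ((d : ℝ) / 2 - 1)) ∂𝔽 := by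
  have h := lintegral_lintegral_Ici_swap (𝔽 := 𝔽) (measurable_weightDensity_integrand (d := d)
    (𝔽 := 𝔽)) R univ
  rw [Measure.restrict_univ] at h
  rw [withDensity_apply _ hR]
  refine Eq.trans h ?_
  congr 1 with u
  rw [lintegral_mul_const' _ _ ENNReal.ofReal_ne_top, mul_comm]

theorem isProbabilityMeasure_withDensity_weightDensity (hd : 2 ≤ d) (h_pos : 𝔽 (Iic 0) = 0)
    (h_ne : 𝔽 ≠ 0) : IsProbabilityMeasure (𝔽.withDensity (weightDensity d 𝔽)) := by
  refine ⟨?_⟩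
  have hzero : 𝔽.withDensity (weightDensity d 𝔽) (Iic 0) = 0 :=
    withDensity_absolutelyContinuous _ _ h_pos
  have huniv : 𝔽.withDensity (weightDensity d 𝔽) univ =
      𝔽.withDensity (weightDensity d 𝔽) (Ioi 0) := by
    rw [← measure_add_measure_compl measurableSet_Iic, hzero, zero_add, compl_Iic]
  rw [huniv, withDensity_weightDensity_apply measurableSet_Ioi]
  simp_rw [Ioi_inter_Iic, ← ofReal_weightRate hd, ← ENNReal.ofReal_mul (Real.exp_pos _).le]
  set f : ℝ → ℝ≥0∞ := fun u => ENNReal.ofReal (Real.exp (-cumWeight d 𝔽 u) * weightRate d 𝔽 u)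
  have hlim := tendsto_measure_Iic_atTop (volume.withDensity f)
  rw [withDensity_apply _ .univ, Measure.restrict_univ] at hlim
  refine tendsto_nhds_unique hlim ?_
  have h1 : Tendsto (fun z => ENNReal.ofReal (1 - Real.exp (-cumWeight d 𝔽 z))) atTop (𝓝 1) := by
    have := (Real.tendsto_exp_neg_atTop_nhds_zero.comp
      (tendsto_cumWeight_atTop hd h_pos h_ne)).const_sub 1
    simpa using ENNReal.tendsto_ofReal this
  refine h1.congr' ?_
  filter_upwards [eventually_ge_atTop 0] with z hz
  rw [withDensity_apply _ measurableSet_Iic, setLIntegral_Iic_exp_neg_cumWeight hd hz]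

theorem withDensity_weightDensity_Ioc (hd : 2 ≤ d) {z : ℝ} (hz : 0 ≤ z) :
    𝔽.withDensity (weightDensity d 𝔽) (Ioc 0 z) =
      ENNReal.ofReal (1 - Real.exp (-cumWeight d 𝔽 z)) +
        ∫⁻ u in Ioi z, ENNReal.ofReal (omega d / 2 * (Real.exp (-cumWeight d 𝔽 u) *
          ∫ h in Ioc 0 z, (u - h) ^ ((d : ℝ) / 2 - 1) ∂𝔽)) := by
  have hd' : (2 : ℝ) ≤ d := by exact_mod_cast hd
  rw [withDensity_weightDensity_apply measurableSet_Ioc,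
    ← lintegral_add_compl _ (measurableSet_Iic (a := z)), compl_Iic,
    ← setLIntegral_Iic_exp_neg_cumWeight hd hz]
  congr 1
  · refine setLIntegral_congr_fun measurableSet_Iic fun u hu => ?_
    simp only [Ioc_inter_Iic, min_eq_right (mem_Iic.1 hu)]
    rw [← ofReal_weightRate hd, ← ENNReal.ofReal_mul (Real.exp_pos _).le]
  · refine setLIntegral_congr_fun measurableSet_Ioi fun u hu => ?_
    have hzu : z ≤ u := le_of_lt hu
    simp only [Ioc_inter_Iic, min_eq_left hzu]
    rw [← ofReal_integral_eq_lintegral_ofReal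
      ((integrableOn_sub_rpow 𝔽 (by linarith) hzu).const_mul _)
      ((ae_restrict_mem measurableSet_Ioc).mono fun t ht =>
        mul_nonneg (div_nonneg (omega_nonneg d) zero_le_two)
          (Real.rpow_nonneg (by linarith [ht.2]) _)),
      integral_const_mul, ← ENNReal.ofReal_mul (Real.exp_pos _).le]
    congr 1
    ring

end

end

theorem mainTheorem4 {Ω : Type*} [MeasurableSpace Ω] (P : Measure Ω) [IsProbabilityMeasure P]
    (d : ℕ) (hd : 2 ≤ d)
    (𝔽 : Measure ℝ) [IsLocallyFiniteMeasure 𝔽] (h_pos : 𝔽 (Iic 0) = 0) (h_ne : 𝔽 ≠ 0)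
    (η : Ω → Measure (WeightedPoint d)) (hη : IsPoissonProcess P η (intensity d 𝔽)) :
    (∀ A : Set ℝ, MeasurableSet A → AEMeasurable (fun ω => volumeBiasedSum (η ω) A) P) ∧
    ∃ FV : Measure ℝ,
      (∀ A : Set ℝ, MeasurableSet A → FV A = volumeBiasedWeight P η A) ∧
      IsProbabilityMeasure FV ∧
      ∀ z : ℝ, 0 ≤ z →
        IntegrableOn (fun u : ℝ =>
          Real.exp (-kappa d * ∫ t in Ioc 0 u, (u - t) ^ ((d : ℝ) / 2) ∂𝔽) *
            ∫ h in Ioc 0 z, (u - h) ^ ((d : ℝ) / 2 - 1) ∂𝔽) (Ioi z) ∧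
        FV.real (Ioc 0 z) =
          1 - Real.exp (-kappa d * ∫ t in Ioc 0 z, (z - t) ^ ((d : ℝ) / 2) ∂𝔽) +
            omega d / 2 * ∫ u in Ioi z,
              Real.exp (-kappa d * ∫ t in Ioc 0 u, (u - t) ^ ((d : ℝ) / 2) ∂𝔽) *
                ∫ h in Ioc 0 z, (u - h) ^ ((d : ℝ) / 2 - 1) ∂𝔽 := by
  have hd' : (2 : ℝ) ≤ d := by exact_mod_cast hd
  have hω : 0 < omega d / 2 := by
    have := kappa_pos d
    rw [omega_eq]
    positivity
  let κ : Kernel Ω (WeightedPoint d) := ⟨η, hη.measurable⟩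
  have hprob := isProbabilityMeasure_withDensity_weightDensity hd h_pos h_ne
  refine ⟨fun A hA => (measurable_volumeBiasedSum κ hη.counting hA).aemeasurable,
    𝔽.withDensity (weightDensity d 𝔽), fun A hA => (volumeBiasedWeight_eq (κ := κ) hd h_pos hη
      hA).symm, hprob, fun z hz => ?_⟩
  set f : ℝ → ℝ := fun u => Real.exp (-cumWeight d 𝔽 u) *
    ∫ h in Ioc 0 z, (u - h) ^ ((d : ℝ) / 2 - 1) ∂𝔽
  have hexp : ∀ u, Real.exp (-kappa d * ∫ t in Ioc 0 u, (u - t) ^ ((d : ℝ) / 2) ∂𝔽) =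
      Real.exp (-cumWeight d 𝔽 u) := fun u => by rw [cumWeight, neg_mul]
  simp_rw [hexp]
  have hmeas : Measurable f := by
    have h : StronglyMeasurable fun u : ℝ => ∫ h in Ioc 0 z, (u - h) ^ ((d : ℝ) / 2 - 1) ∂𝔽 :=
      (by fun_prop : Measurable fun p : ℝ × ℝ =>
        (p.1 - p.2) ^ ((d : ℝ) / 2 - 1)).stronglyMeasurable.integral_prod_right'
    exact measurable_cumWeight.neg.exp.mul h.measurable
  have hnonneg : 0 ≤ᵐ[volume.restrict (Ioi z)] fun u => omega d / 2 * f u :=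
    (ae_restrict_mem measurableSet_Ioi).mono fun u hu =>
      mul_nonneg hω.le (mul_nonneg (Real.exp_pos _).le (setIntegral_nonneg measurableSet_Ioc
        fun t ht => Real.rpow_nonneg (by linarith [ht.2, mem_Ioi.1 hu]) _))
  have hFV := withDensity_weightDensity_Ioc (𝔽 := 𝔽) hd hz
  have hfin : ∫⁻ u in Ioi z, ENNReal.ofReal (omega d / 2 * f u) ≠ ∞ := fun h => by
    rw [h, add_top] at hFV
    exact measure_ne_top _ _ hFV
  have hint : IntegrableOn (fun u => omega d / 2 * f u) (Ioi z) :=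
    (lintegral_ofReal_ne_top_iff_integrable (hmeas.const_mul _).aestronglyMeasurable hnonneg).1
      hfin
  refine ⟨(integrable_const_mul_iff (isUnit_iff_ne_zero.2 hω.ne') f).1 hint, ?_⟩
  rw [measureReal_def, hFV, ENNReal.toReal_add ENNReal.ofReal_ne_top hfin,
    ENNReal.toReal_ofReal (sub_nonneg.2 (Real.exp_le_one_iff.2
      (neg_nonpos.2 (cumWeight_nonneg d 𝔽 z)))),
    ← ofReal_integral_eq_lintegral_ofReal hint hnonneg, ENNReal.toReal_ofReal
      (integral_nonneg_of_ae hnonneg), integral_const_mul]
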